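/- For $N\ge 0$ let $E^{(N)}=\{\{0,1,2\},\{1,2,3\},\dots,\{N-3,N-2,N-1\}\}$ be the chain hypergraph on $\{0,\dots,N-1\}$ (empty for $N\le 2$), and let $|\psi_N\rangle=\prod_{\{i,j,k\}\in E^{(N)}}CCZ_{i,j,k}\,|+\rangle^{\otimes N}$ be its hypergraph state. The Pauli–Liouville (PL) moment of an $N$-qubit state $|\psi\rangle$ is $$m_\alpha(\psi)=\frac1{2^N}\sum_{x,z\in\{0,1\}^N}\bigl|\langle\psi|P^{x,z}|\psi\rangle\bigr|^{2\alpha},\qquad P^{x,z}=\sqrt{-1}^{\,x\cdot z}X^xZ^z .$$ For $x\in GF(2)^N$ let $C(x)$ be the strictly upper triangular $GF(2)$ matrix with $C_{i,j}(x)=\sum_{k:\{i,j,k\}\in E^{(N)}}x_k$ for $i<j$, and let $2h(x)$ be the rank over $GF(2)$ of $C(x)+C(x)^T$. For real $\alpha$, $A\subseteq\{0,\dots,N-1\}$ and prescribed bits $y_i$ ($i\in A$), the partially fixed PL moment is $$m^{(N)}_{\alpha,(x_i=y_i)_{i\in A}}=\frac1{2^{N-|A|}}\sum_{x:\;x_i=y_i\,(i\in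 A)}2^{(1-\alpha)2h(x)} .$$ Write $m^{(N)}_\alpha$ for $A=\emptyset$, $m^{(N)}_{\alpha,(y_0)}$ for $x_0=y_0$ fixed ($N\ge1$), and $m^{(N)}_{\alpha,(y_0,y_1)}$ for $x_0=y_0$, $x_1=y_1$ fixed ($N\ge2$). Put $\beta=2^{2(1-\alpha)}$. Then, for every real $\alpha$: 1. For all $N\ge4$, $$m^{(N)}_{\alpha,(0,0)}=\tfrac14m^{(N-2)}_{\alpha,(0,0)}+\tfrac\beta2m^{(N-2)}_{\alpha,(1)}+\tfrac\beta4m^{(N-3)}_{\alpha,(1)},$$ $$m^{(N)}_{\alpha,(1)}=\tfrac\beta2m^{(N-2)}_{\alpha,(1)}+\tfrac18m^{(N-2)}_{\alpha,(0,1)}+\tfrac\beta4m^{(N-3)}_{\alpha,(0)}+\tfrac\beta8m^{(N-3)}_{\alpha,(1)},$$ $$m^{(N)}_{\alpha,(0,1)}=\tfrac\beta2m^{(N-2)}_{\alpha,(1)}+\tfrac\beta2m^{(N-3)}_{\alpha}.$$ 2. Let $$A=\begin{pmatrix}\frac14&0&\frac\beta2\\0&0&\frac\beta2\\0&\frac18&\frac\beta2\end{pmatrix},\quad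 B=\begin{pmatrix}0&\frac\beta4\\\frac\beta4&\frac\beta4\\\frac\beta4&\frac\beta8\end{pmatrix},\quad C=\begin{pmatrix}\frac12&\frac12&0\\0&0&1\end{pmatrix},\quad \mathcal A=\begin{pmatrix}0&A&B\\I_3&0&0\\0&C&0\end{pmatrix},$$ let $v_N=(m^{(N)}_{\alpha,(0,0)},m^{(N)}_{\alpha,(0,1)},m^{(N)}_{\alpha,(1)})^T$, $w_N=(m^{(N)}_{\alpha,(0)},m^{(N)}_{\alpha,(1)})^T$, and let $\mathcal M_N=(v_N,v_{N-1},w_{N-2})^T\in\mathbb R^8$ for $N\ge3$. For all $N\ge4$, $v_N=Av_{N-2}+Bw_{N-3}$ and $\mathcal M_N=\mathcal A\,\mathcal M_{N-1}$. 3. The initial values are $m^{(3)}_{\alpha,(0,0)}=\frac{1+\beta}2$, $m^{(3)}_{\alpha,(0,1)}=m^{(3)}_{\alpha,(1)}=\beta$; $m^{(4)}_{\alpha,(0,0)}=\frac{1+3\beta}4$, $m^{(4)}_{\alpha,(0,1)}=\beta$, $m^{(4)}_{\alpha,(1)}=\frac{1+7\beta}8$; and $m^{(2)}_{\alpha,(y_0,y_1)}=m^{(2)}_{\alpha,(y_0)}=m^{(1)}_{\alpha,(y_0)}=1$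 for all bits $y_0,y_1$. 4. For all $N\ge2$, $m^{(N)}_\alpha=\frac14\bigl(m^{(N)}_{\alpha,(0,0)}+m^{(N)}_{\alpha,(0,1)}\bigr)+\frac12m^{(N)}_{\alpha,(1)}$. 5. For all $N\ge3$, $\mathcal M_N=\mathcal A^{N-3}\mathcal M_3$ with $\mathcal M_3=\bigl(\frac{1+\beta}2,\beta,\beta,1,1,1,1,1\bigr)^T$. 6. If $\alpha>0$, then $m_\alpha(\psi_N)=m^{(N)}_\alpha$ for all $N\ge 0$. Consequently $m_\alpha(\psi_N)=1$ for $N\le2$, and for all $N\ge3$ the PL moment is given exactly by $m_\alpha(\psi_N)=\frac14(u_1+u_2)+\frac12u_3$, where $u=\mathcal A^{N-3}\bigl(\frac{1+\beta}2,\beta,\beta,1,1,1,1,1\bigr)^T$. -/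

import Mathlib

open scoped Matrix

noncomputable section

namespace Hypergraph

/-- Bit strings of length `N`; they label the computational basis of `N` qubits. -/
abbrev Bits (N : ℕ) : Type := Fin N → ZMod 2

/-- A pure state vector of `N` qubits, given by its amplitudes in the computational basis. -/
abbrev StateVec (N : ℕ) : Type := Bits N → ℂ

/-- The single-qubit Pauli matrix `X`. -/
def pauliX : Matrix (ZMod 2) (ZMod 2) ℂ := Matrix.of fun b a => if b = a + 1 then 1 else 0

/-- The single-qubit Pauli matrix `Z`. -/
def pauliZ : Matrix (ZMod 2) (ZMod 2) ℂ := Matrix.diagonal fun a => if a = 1 then -1 else 1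

/-- The single-qubit operator `√-1 ^ (x z) X ^ x Z ^ z`. -/
def pauliOne (x z : ZMod 2) : Matrix (ZMod 2) (ZMod 2) ℂ :=
  (Complex.I ^ (x.val * z.val)) • (pauliX ^ x.val * pauliZ ^ z.val)

/-- The Pauli string `P^{x,z} = √-1 ^ (x · z) X^x Z^z`, as the tensor product of its single-qubit
factors. -/
def pauliString {N : ℕ} (x z : Bits N) : Matrix (Bits N) (Bits N) ℂ :=
  Matrix.of fun b a => ∏ i, pauliOne (x i) (z i) (b i) (a i)

/-- The Pauli-Liouville moment
`m_α = 2^{-N} ∑_{x,z} |⟨ψ| P^{x,z} |ψ⟩|^{2α}` of a state `ψ`. -/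
def plMoment {N : ℕ} (α : ℝ) (ψ : StateVec N) : ℝ :=
  (1 / 2 ^ N) * ∑ x : Bits N, ∑ z : Bits N, ‖star ψ ⬝ᵥ (pauliString x z *ᵥ ψ)‖ ^ (2 * α)

/-- The state `|+⟩^{⊗ N}`. -/
def plusState (N : ℕ) : StateVec N := fun _ => ((1 / Real.sqrt 2 : ℝ) : ℂ) ^ N

/-- The multiply controlled `Z` gate on the qubits in `e`: the identity minus twice the projection
on the basis states that have a `1` at every qubit of `e`. For `|e| = 3` this is `CCZ`. -/
def controlledZ {N : ℕ} (e : Finset (Fin N)) : Matrix (Bits N) (Bits N) ℂ :=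
  1 - (2 : ℂ) • Matrix.diagonal fun a => if ∀ i ∈ e, a i = 1 then 1 else 0

theorem controlledZ_commute {N : ℕ} (e f : Finset (Fin N)) :
    Commute (controlledZ e) (controlledZ f) := by
  unfold controlledZ
  have h := (Matrix.commute_diagonal (fun a : Bits N => if ∀ i ∈ e, a i = 1 then (1 : ℂ) else 0)
    (fun a : Bits N => if ∀ i ∈ f, a i = 1 then (1 : ℂ) else 0))
  exact ((Commute.one_left _).sub_left
    (((Commute.one_right _).sub_right ((h.smul_left _).smul_right _))))

/-- The hypergraph state `∏_{e ∈ E} CZ_e |+⟩^{⊗ N}` of a set `E` of hyperedges. -/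
def hypergraphState {N : ℕ} (E : Finset (Finset (Fin N))) : StateVec N :=
  (E.noncommProd controlledZ fun e _ f _ _ => controlledZ_commute e f) *ᵥ plusState N

/-- The strictly upper triangular matrix `C_{i,j}(x) = ∑_{k : {i,j,k} ∈ E} x_k` (`i < j`) over
`GF(2)` of a 3-uniform hypergraph. -/
def cMatrix {N : ℕ} (E : Finset (Finset (Fin N))) (x : Bits N) :
    Matrix (Fin N) (Fin N) (ZMod 2) :=
  Matrix.of fun i j => if i < j then ∑ k with ({i, j, k} : Finset (Fin N)) ∈ E, x k else 0

/-- The rank `2h(x)` of the symmetric `GF(2)` matrix `C(x) + C(x)ᵀ`. -/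
def twoH {N : ℕ} (E : Finset (Finset (Fin N))) (x : Bits N) : ℕ :=
  (cMatrix E x + (cMatrix E x)ᵀ).rank

/-- The moment with fixed values `x_i = y_i` for `i ∈ A`:
`2^{-(N-|A|)} ∑_{x, x_i = y_i (i ∈ A)} 2^{(1-α) 2h(x)}`. -/
def fixedMoment {N : ℕ} (α : ℝ) (E : Finset (Finset (Fin N))) (A : Finset (Fin N))
    (y : Bits N) : ℝ :=
  (1 / 2 ^ (N - A.card)) *
    ∑ x : Bits N with ∀ i ∈ A, x i = y i, (2 : ℝ) ^ ((1 - α) * (twoH E x : ℝ))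

/-- The hyperedges `{0,1,2}, {1,2,3}, …, {N-3,N-2,N-1}` of the chain on `N` vertices. -/
def chain (N : ℕ) : Finset (Finset (Fin N)) :=
  Finset.univ.filter fun e => ∃ i j k : Fin N,
    (j : ℕ) = i + 1 ∧ (k : ℕ) = i + 2 ∧ e = {i, j, k}

/-- `m α N [y₀, …, y_{l-1}]` is the moment `m^{(N)}_{α,(y₀,…,y_{l-1})}` of the chain on `N` qubits
with the first `l` bits of `x` fixed (used for `l ≤ N`); `m α N []` has no bit fixed. -/
def m (α : ℝ) (N : ℕ) (y : List (ZMod 2)) : ℝ :=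
  fixedMoment α (chain N) {i | (i : ℕ) < y.length} fun i => y.getD i 0

/-- The Pauli-Liouville moment of the hypergraph state of the chain on `N` qubits. -/
def chainPL (α : ℝ) (N : ℕ) : ℝ := plMoment α (hypergraphState (chain N))

/-- `β = 2^{2(1-α)}`. -/
def β (α : ℝ) : ℝ := (2 : ℝ) ^ (2 * (1 - α))

def matA (α : ℝ) : Matrix (Fin 3) (Fin 3) ℝ :=
  !![1 / 4, 0, β α / 2;
     0, 0, β α / 2;
     0, 1 / 8, β α / 2]

def matB (α : ℝ) : Matrix (Fin 3) (Fin 2) ℝ :=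
  !![0, β α / 4;
     β α / 4, β α / 4;
     β α / 4, β α / 8]

def matC : Matrix (Fin 2) (Fin 3) ℝ :=
  !![1 / 2, 1 / 2, 0;
     0, 0, 1]

/-- Index set of the eight components, in three blocks of sizes 3, 3, 2. -/
abbrev Idx : Type := Fin 3 ⊕ (Fin 3 ⊕ Fin 2)

/-- The block matrix with rows `(0, A, B)`, `(I, 0, 0)`, `(0, C, 0)`. -/
def transfer (α : ℝ) : Matrix Idx Idx ℝ :=
  Matrix.fromBlocks 0 (Matrix.fromCols (matA α) (matB α))
    (Matrix.fromRows 1 0) (Matrix.fromBlocks 0 0 matC 0)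

/-- The vector `(m_{(0,0)}, m_{(0,1)}, m_{(1)})` at size `N`. -/
def vec3 (α : ℝ) (N : ℕ) : Fin 3 → ℝ := ![m α N [0, 0], m α N [0, 1], m α N [1]]

/-- The vector `(m_{(0)}, m_{(1)})` at size `N`. -/
def vec2 (α : ℝ) (N : ℕ) : Fin 2 → ℝ := ![m α N [0], m α N [1]]

/-- The vector `𝓜_N` (used for `3 ≤ N`). -/
def vecM (α : ℝ) (N : ℕ) : Idx → ℝ :=
  Sum.elim (vec3 α N) (Sum.elim (vec3 α (N - 1)) (vec2 α (N - 2)))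

/-- The explicit initial vector of the matrix recursion. -/
def initM (α : ℝ) : Idx → ℝ :=
  Sum.elim ![(1 + β α) / 2, β α, β α] (Sum.elim ![1, 1, 1] ![1, 1])

/-- The linear functional `(v_{(0,0)} + v_{(0,1)}) / 4 + v_{(1)} / 2` of the first block. -/
def total (v : Idx → ℝ) : ℝ := (v (.inl 0) + v (.inl 1)) / 4 + v (.inl 2) / 2

end Hypergraph

end

open scoped Matrix

noncomputable section

namespace Hypergraph

/-! Two independent arguments meet in the exponent `2h(x)`. Recursion: the rank is read off from the
kernel, since `2^rank * |ker| = 2^N`. For the chain, row `i` of `C(x) + C(x)ᵀ` involves only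
vertices at distance at most 2 from `i`. Once the leading bits of `x` are known, the first rows can
be solved for the leading coordinates of `v`. What remains is the kernel system of a shorter chain,
so the rank drops by 0 or 2 (the `annihilates_*` and `twoH_*` lemmas). Averaging over the leading
bits gives the recursions, with a factor `β` for each drop by 2. Pauli–Liouville moment: an
expectation of `P^{x,z}` is, up to a phase, a normalized sign sum of a derivative of the cubic edge
form. This derivative is quadratic with polarization `C(x) + C(x)ᵀ`, so the squared expectation is 0
or `2^{-2h(x)}` (`sq_sum_sgn_eq_zero_or`). By Parseval the squares sum to 1 over `z`, so exactly
`2^{2h(x)}` of them are nonzero, and their `α`-th powers sum to `2^{(1-α)2h(x)}`. -/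

/-! ### Rank, kernel and the edges of the chain. -/

theorem two_pow_rank_mul_card_ker {N : ℕ} (M : Matrix (Fin N) (Fin N) (ZMod 2)) :
    2 ^ M.rank * (Finset.univ.filter fun v : Bits N => M *ᵥ v = 0).card = 2 ^ N := by
  have h1 := LinearMap.finrank_range_add_finrank_ker M.mulVecLin
  have h2 : (Finset.univ.filter fun v : Bits N => M *ᵥ v = 0).card
      = 2 ^ Module.finrank (ZMod 2) (LinearMap.ker M.mulVecLin) := by
    have := Module.natCard_eq_pow_finrank (K := ZMod 2) (V := LinearMap.ker M.mulVecLin)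
    rw [Nat.card_zmod] at this
    rw [← this, ← Fintype.card_subtype, ← Nat.card_eq_fintype_card]
    rfl
  rw [h2, ← pow_add, Matrix.rank, h1, Module.finrank_fin_fun]

theorem cMatrix_add_transpose_apply {N : ℕ} {E : Finset (Finset (Fin N))}
    (hE : ∀ e ∈ E, e.card = 3) (x : Bits N) (i j : Fin N) :
    (cMatrix E x + (cMatrix E x)ᵀ) i j =
      ∑ k, if ({i, j, k} : Finset (Fin N)) ∈ E then x k else 0 := by
  rw [← Finset.sum_filter]
  simp only [cMatrix, Matrix.add_apply, Matrix.transpose_apply, Matrix.of_apply]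
  rcases lt_trichotomy i j with h | rfl | h
  · simp [h, h.not_gt]
  · rw [Finset.filter_false_of_mem]
    · simp
    · intro k _ hk
      have := hE _ hk
      have h2 : ({i, i, k} : Finset (Fin N)).card ≤ 2 := by
        simpa using Finset.card_le_two (a := i) (b := k)
      omega
  · simp only [h, h.not_gt, if_true, if_false, zero_add]
    refine Finset.sum_congr ?_ fun _ _ => rfl
    ext k
    simp [Finset.insert_comm]

theorem card_of_mem_chain {N : ℕ} {e : Finset (Fin N)} (he : e ∈ chain N) : e.card = 3 := by
  simp only [chain, Finset.mem_filter, Finset.mem_univ, true_and] at he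
  obtain ⟨i, j, k, hj, hk, rfl⟩ := he
  rw [Finset.card_eq_three]
  refine ⟨i, j, k, ?_, ?_, ?_, rfl⟩ <;> (intro h; rw [Fin.ext_iff] at h; omega)

/-- Three natural numbers are, in some order, consecutive. -/
def Consecutive (i j k : ℕ) : Prop :=
  i ≠ j ∧ j ≠ k ∧ i ≠ k ∧ i ≤ j + 2 ∧ j ≤ i + 2 ∧ j ≤ k + 2 ∧ k ≤ j + 2 ∧ i ≤ k + 2 ∧ k ≤ i + 2

instance (i j k : ℕ) : Decidable (Consecutive i j k) := by unfold Consecutive; infer_instance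

theorem mem_chain_iff {N : ℕ} (i j k : Fin N) :
    ({i, j, k} : Finset (Fin N)) ∈ chain N ↔ Consecutive i j k := by
  constructor
  · intro h
    have h3 := card_of_mem_chain h
    have hij : i ≠ j := by
      rintro rfl
      have : ({i, i, k} : Finset (Fin N)).card ≤ 2 := by
        simpa using Finset.card_le_two (a := i) (b := k)
      omega
    have hjk : j ≠ k := by
      rintro rfl
      have : ({i, j, j} : Finset (Fin N)).card ≤ 2 := by
        simpa using Finset.card_le_two (a := i) (b := j)
      omega
    have hik : i ≠ k := by
      rintro rfl
      have : ({i, j, i} : Finset (Fin N)).card ≤ 2 := by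
        rw [Finset.insert_eq_of_mem (by simp)]
        exact Finset.card_le_two
      omega
    simp only [chain, Finset.mem_filter, Finset.mem_univ, true_and] at h
    obtain ⟨a, b, c, hb, hc, he⟩ := h
    have hi : i ∈ ({a, b, c} : Finset (Fin N)) := he ▸ by simp
    have hj : j ∈ ({a, b, c} : Finset (Fin N)) := he ▸ by simp
    have hk : k ∈ ({a, b, c} : Finset (Fin N)) := he ▸ by simp
    simp only [Finset.mem_insert, Finset.mem_singleton, Fin.ext_iff] at hi hj hk
    simp only [ne_eq, Fin.ext_iff] at hij hjk hik
    unfold Consecutive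
    omega
  · rintro ⟨h1, h2, h3, h4⟩
    simp only [chain, Finset.mem_filter, Finset.mem_univ, true_and]
    rcases lt_or_gt_of_ne h1 with a | a <;> rcases lt_or_gt_of_ne h2 with b | b <;>
      rcases lt_or_gt_of_ne h3 with c | c
    · exact ⟨i, j, k, by omega, by omega, rfl⟩
    · omega
    · exact ⟨i, k, j, by omega, by omega, by rw [Finset.pair_comm]⟩
    · exact ⟨k, i, j, by omega, by omega, by ext; simp; tauto⟩
    · exact ⟨j, i, k, by omega, by omega, by ext; simp; tauto⟩
    · exact ⟨j, k, i, by omega, by omega, by ext; simp; tauto⟩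
    · omega
    · exact ⟨k, j, i, by omega, by omega, by ext; simp; tauto⟩

/-! ### The kernel equations as local conditions on zero-padded sequences. -/

/-- Prepend a bit to an infinite sequence. -/
def pcons (a : ZMod 2) (X : ℕ → ZMod 2) : ℕ → ZMod 2
  | 0 => a
  | n + 1 => X n

/-- Extension of a bit string by zeros to an infinite sequence. -/
def extend {N : ℕ} (x : Bits N) : ℕ → ZMod 2 := fun n => if h : n < N then x ⟨n, h⟩ else 0

theorem extend_cons {N : ℕ} (a : ZMod 2) (x : Bits N) :
    extend (Fin.cons a x : Bits (N + 1)) = pcons a (extend x) := by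
  funext n
  cases n with
  | zero => simp [extend, pcons]
  | succ n =>
    simp only [extend, pcons, Nat.add_lt_add_iff_right]
    split_ifs with h
    · exact Fin.cons_succ (α := fun _ => ZMod 2) a x ⟨n, h⟩
    · rfl

/-- The contribution to row `i` of `C(x) + C(x)ᵀ` applied to `v`, in terms of two sequences whose
entry `i + 2` corresponds to vertex `i`. -/
def localRow (X V : ℕ → ZMod 2) (i : ℕ) : ZMod 2 :=
  X (i + 3) * V (i + 4) + X (i + 4) * V (i + 3) + X (i + 1) * V (i + 3) + X (i + 3) * V (i + 1)
    + X i * V (i + 1) + X (i + 1) * V i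

theorem sum_range_window {R : Type*} [AddCommMonoid R] {n i : ℕ} (f : ℕ → R) (hi : i + 5 ≤ n)
    (hf : ∀ j, ¬ (i ≤ j ∧ j < i + 5) → f j = 0) :
    ∑ j ∈ Finset.range n, f j = ∑ d ∈ Finset.range 5, f (i + d) := by
  rw [Finset.range_eq_Ico, ← Finset.sum_subset (s₁ := Finset.Ico i (i + 5)),
    Finset.sum_Ico_eq_sum_range]
  · simp
  · intro j; simp; omega
  · intro j _ hj; exact hf j (by simpa using hj)

/-- Two zeros on each side (the right ones come from `extend`) let the five-entry window of every
row fit inside the range, so no boundary case arises. -/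
theorem sum_fin_eq_sum_range_pad {N : ℕ} (x : Bits N) (c : ℕ → ZMod 2) :
    ∑ k : Fin N, c (k + 2) * x k =
      ∑ k ∈ Finset.range (N + 4), c k * pcons 0 (pcons 0 (extend x)) k := by
  rw [Finset.sum_range_succ', Finset.sum_range_succ', Finset.sum_range_succ,
    Finset.sum_range_succ, Finset.sum_range]
  simp [pcons, extend, add_assoc]

theorem mulVec_chain_apply {N : ℕ} (x v : Bits N) (i : Fin N) :
    ((cMatrix (chain N) x + (cMatrix (chain N) x)ᵀ) *ᵥ v) i =
      localRow (pcons 0 (pcons 0 (extend x))) (pcons 0 (pcons 0 (extend v))) i := by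
  set X := pcons 0 (pcons 0 (extend x)) with hX
  set V := pcons 0 (pcons 0 (extend v)) with hV
  have hT : ∀ j k : Fin N, Consecutive i j k ↔ Consecutive (i + 2) (j + 2) (k + 2) := by
    intro j k; unfold Consecutive; omega
  have key : ∀ j, ∑ k ∈ Finset.range (N + 4), (if Consecutive (i + 2) j k then 1 else 0) * X k
      = ∑ d ∈ Finset.range 5, (if Consecutive (i + 2) j (i + d) then 1 else 0) * X (i + d) := by
    intro j
    refine sum_range_window _ (by omega) fun k hk => ?_
    rw [if_neg, zero_mul]
    unfold Consecutive; omega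
  calc ((cMatrix (chain N) x + (cMatrix (chain N) x)ᵀ) *ᵥ v) i
      = ∑ j : Fin N, (∑ k : Fin N,
          (if Consecutive (i + 2) (j + 2) (k + 2) then 1 else 0) * x k) * v j := by
        simp only [Matrix.mulVec, dotProduct]
        refine Finset.sum_congr rfl fun j _ => ?_
        rw [cMatrix_add_transpose_apply fun e => card_of_mem_chain]
        congr 1
        refine Finset.sum_congr rfl fun k _ => ?_
        simp only [mem_chain_iff, hT, ite_mul, one_mul, zero_mul]
    _ = ∑ j ∈ Finset.range (N + 4), (∑ d ∈ Finset.range 5,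
          (if Consecutive (i + 2) j (i + d) then 1 else 0) * X (i + d)) * V j := by
        rw [← sum_fin_eq_sum_range_pad v fun j => ∑ d ∈ Finset.range 5,
          (if Consecutive (i + 2) j (i + d) then 1 else 0) * X (i + d)]
        refine Finset.sum_congr rfl fun j _ => ?_
        rw [← key, sum_fin_eq_sum_range_pad x fun k =>
          if Consecutive (i + 2) (j + 2) k then 1 else 0]
    _ = localRow X V i := by
        rw [sum_range_window (i := i) _ (by omega)]
        -- Translation invariance reduces every row to the window `0, …, 4` centred at 2, a finite
        -- check.
        · have hs : ∀ d e : ℕ, Consecutive (i + 2) (i + d) (i + e) ↔ Consecutive 2 d e := by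
            intro d e; unfold Consecutive; omega
          simp only [hs]
          simp [Finset.sum_range_succ, Consecutive, localRow]
          ring
        · intro j hj
          rw [Finset.sum_eq_zero, zero_mul]
          intro d _
          rw [if_neg, zero_mul]
          unfold Consecutive; omega

/-! ### Elimination of the leading coordinates. -/

/-- The first `N` rows annihilate the sequence `V`. -/
def Annihilates (N : ℕ) (X V : ℕ → ZMod 2) : Prop := ∀ i < N, localRow X V i = 0

instance (N : ℕ) (X V : ℕ → ZMod 2) : Decidable (Annihilates N X V) := by
  unfold Annihilates; infer_instance

theorem mulVec_chain_eq_zero_iff {N : ℕ} (x v : Bits N) :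
    (cMatrix (chain N) x + (cMatrix (chain N) x)ᵀ) *ᵥ v = 0 ↔
      Annihilates N (pcons 0 (pcons 0 (extend x))) (pcons 0 (pcons 0 (extend v))) := by
  rw [funext_iff]
  simp only [mulVec_chain_apply, Pi.zero_apply]
  exact ⟨fun h i hi => h ⟨i, hi⟩, fun h i => h i i.2⟩

theorem annihilates_succ (N : ℕ) (a b : ZMod 2) (X V : ℕ → ZMod 2) :
    Annihilates (N + 1) (pcons a X) (pcons b V) ↔
      localRow (pcons a X) (pcons b V) 0 = 0 ∧ Annihilates N X V := by
  constructor
  · intro h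
    refine ⟨h 0 (by omega), fun i hi => ?_⟩
    rw [← h (i + 1) (by omega)]
    rfl
  · rintro ⟨h0, h⟩ i hi
    cases i with
    | zero => exact h0
    | succ i =>
      rw [← h i (by omega)]
      rfl

/-- Entries 0 and 1 are read only by rows 0 and 1. After elimination, this allows the removed
vertices still present on the left to be replaced by zero padding. -/
theorem annihilates_congr {N : ℕ} {a b c d a' b' c' d' : ZMod 2} {X V : ℕ → ZMod 2}
    (h0 : localRow (pcons a (pcons b X)) (pcons c (pcons d V)) 0 =
      localRow (pcons a' (pcons b' X)) (pcons c' (pcons d' V)) 0)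
    (h1 : localRow (pcons b X) (pcons d V) 0 = localRow (pcons b' X) (pcons d' V) 0) :
    Annihilates N (pcons a (pcons b X)) (pcons c (pcons d V)) ↔
      Annihilates N (pcons a' (pcons b' X)) (pcons c' (pcons d' V)) := by
  unfold Annihilates
  refine forall₂_congr fun i _ => ?_
  match i with
  | 0 => rw [h0]
  | 1 =>
    change localRow (pcons b X) (pcons d V) 0 = 0 ↔ localRow (pcons b' X) (pcons d' V) 0 = 0
    rw [h1]
  | i + 2 => rfl

/-- The bit `x₂ = 1` is the pivot of rows 0 and 1, which determine `v₁` and `v₀`. Substituting them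
removes both vertices from the later rows. -/
theorem annihilates_one_third (n : ℕ) (x₀ x₁ v₀ v₁ : ZMod 2) (Y W : ℕ → ZMod 2) :
    Annihilates (n + 2) (pcons 0 (pcons 0 (pcons x₀ (pcons x₁ (pcons 1 Y)))))
      (pcons 0 (pcons 0 (pcons v₀ (pcons v₁ W)))) ↔
    v₁ = x₁ * W 0 ∧ v₀ = W 1 + (Y 0 + x₀) * W 0 ∧
      Annihilates n (pcons 0 (pcons 0 (pcons 1 Y))) (pcons 0 (pcons 0 W)) := by
  rw [annihilates_succ, annihilates_succ]
  refine and_congr ?_ (and_congr_left' ?_) |>.trans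
    (and_congr_right fun h1 => and_congr_right fun h2 => annihilates_congr ?_ ?_) <;>
  · simp only [localRow, pcons]
    grind

/-- Row 0 forces `v₂ = 0`, row 1 is then vacuous, and row 2 determines `v₀`; `v₁` stays free. -/
theorem annihilates_one_zero (n : ℕ) (x₀ v₀ v₁ v₂ : ZMod 2) (Y W : ℕ → ZMod 2) :
    Annihilates (n + 3) (pcons 0 (pcons 0 (pcons x₀ (pcons 1 (pcons 0 Y)))))
      (pcons 0 (pcons 0 (pcons v₀ (pcons v₁ (pcons v₂ W))))) ↔
    v₂ = 0 ∧ v₀ = Y 0 * W 1 + Y 1 * W 0 + W 0 + Y 0 * v₁ + x₀ * v₁ ∧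
      Annihilates n (pcons 0 (pcons 0 Y)) (pcons 0 (pcons 0 W)) := by
  rw [annihilates_succ, annihilates_succ, annihilates_succ]
  have e0 : localRow (pcons 0 (pcons 0 (pcons x₀ (pcons 1 (pcons 0 Y)))))
      (pcons 0 (pcons 0 (pcons v₀ (pcons v₁ (pcons v₂ W))))) 0 = 0 ↔ v₂ = 0 := by
    simp only [localRow, pcons]
    grind
  rw [e0]
  refine and_congr_right fun h => ?_
  rw [and_iff_right]
  · refine (and_congr_left' ?_).trans (and_congr_right fun _ => annihilates_congr ?_ ?_) <;>
    · simp only [localRow, pcons]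
      grind
  · simp only [localRow, pcons]
    grind

theorem annihilates_zero_zero_zero (n : ℕ) (v₀ : ZMod 2) (Y W : ℕ → ZMod 2) :
    Annihilates (n + 1) (pcons 0 (pcons 0 (pcons 0 (pcons 0 (pcons 0 Y)))))
      (pcons 0 (pcons 0 (pcons v₀ W))) ↔
    Annihilates n (pcons 0 (pcons 0 (pcons 0 (pcons 0 Y)))) (pcons 0 (pcons 0 W)) := by
  rw [annihilates_succ, and_iff_right]
  · refine annihilates_congr ?_ ?_ <;>
    · simp only [localRow, pcons]
      grind
  · simp only [localRow, pcons]
    grind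

/-- Row 0 is zero, and in row 1 the contributions of the two bits equal to 1 cancel in
characteristic 2. Both removed coordinates are free. -/
theorem annihilates_one_zero_zero_one (n : ℕ) (v₀ v₁ : ZMod 2) (Y W : ℕ → ZMod 2) :
    Annihilates (n + 2) (pcons 0 (pcons 0 (pcons 1 (pcons 0 (pcons 0 (pcons 1 Y))))))
      (pcons 0 (pcons 0 (pcons v₀ (pcons v₁ W)))) ↔
    Annihilates n (pcons 0 (pcons 0 (pcons 0 (pcons 1 Y)))) (pcons 0 (pcons 0 W)) := by
  rw [annihilates_succ, annihilates_succ, and_iff_right, and_iff_right]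
  · refine annihilates_congr ?_ ?_ <;>
    · simp only [localRow, pcons]
      grind
  all_goals
    simp only [localRow, pcons]
    grind

/-- Row 0 is zero, and rows 1 and 2 have the leading bit 1 as pivot for `v₂` and `v₁`; `v₀` is free.
-/
theorem annihilates_one_zero_zero_zero (n : ℕ) (v₀ v₁ v₂ : ZMod 2) (Y W : ℕ → ZMod 2) :
    Annihilates (n + 3) (pcons 0 (pcons 0 (pcons 1 (pcons 0 (pcons 0 (pcons 0 Y))))))
      (pcons 0 (pcons 0 (pcons v₀ (pcons v₁ (pcons v₂ W))))) ↔
    v₂ = 0 ∧ v₁ = Y 0 * W 0 ∧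
      Annihilates n (pcons 0 (pcons 0 (pcons 0 Y))) (pcons 0 (pcons 0 W)) := by
  rw [annihilates_succ, annihilates_succ, annihilates_succ, and_iff_right]
  · refine and_congr ?_ (and_congr_left' ?_) |>.trans
      (and_congr_right fun h1 => and_congr_right fun h2 => annihilates_congr ?_ ?_) <;>
    · simp only [localRow, pcons]
      grind
  · simp only [localRow, pcons]
    grind

/-! ### From kernel sizes to ranks. -/

/-- Number of elements of the kernel of `C(x) + C(x)ᵀ` for the chain. -/
def kerCard {N : ℕ} (x : Bits N) : ℕ :=
  ∑ v : Bits N, if Annihilates N (pcons 0 (pcons 0 (extend x))) (pcons 0 (pcons 0 (extend v)))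
    then 1 else 0

theorem two_pow_twoH_mul_kerCard {N : ℕ} (x : Bits N) :
    2 ^ twoH (chain N) x * kerCard x = 2 ^ N := by
  rw [kerCard, ← Finset.card_filter]
  simp only [← mulVec_chain_eq_zero_iff]
  exact two_pow_rank_mul_card_ker _

theorem kerCard_pos {N : ℕ} (x : Bits N) : 0 < kerCard x :=
  Nat.pos_of_ne_zero fun h => by
    have := two_pow_twoH_mul_kerCard x
    rw [h, mul_zero] at this
    exact absurd this.symm (by positivity)

/-- Of the `k + r` removed coordinates, `k` are free and `r` are determined; only the latter add to
the rank. -/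
theorem twoH_of_kerCard {N n k r : ℕ} {x : Bits N} {y : Bits n} (hN : N = n + k + r)
    (h : kerCard x = 2 ^ k * kerCard y) : twoH (chain N) x = r + twoH (chain n) y := by
  have h1 := two_pow_twoH_mul_kerCard x
  have h2 := two_pow_twoH_mul_kerCard y
  have h3 : 2 ^ (twoH (chain N) x + k) * kerCard y
      = 2 ^ (r + twoH (chain n) y + k) * kerCard y := by
    calc _ = 2 ^ N := by rw [← h1, h, pow_add]; ring
      _ = 2 ^ n * 2 ^ k * 2 ^ r := by rw [hN, pow_add, pow_add]
      _ = _ := by rw [← h2]; ring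
  have h4 := Nat.pow_right_injective le_rfl (Nat.eq_of_mul_eq_mul_right (kerCard_pos y) h3)
  omega

theorem sum_bits_succ {R : Type*} [AddCommMonoid R] {n : ℕ} (F : Bits (n + 1) → R) :
    ∑ x, F x = ∑ y : Bits n, ∑ a : ZMod 2, F (Fin.cons a y) := by
  rw [← Fintype.sum_prod_type_right']
  exact (Equiv.sum_comp (Fin.consEquiv fun _ => ZMod 2) F).symm

theorem twoH_one_third {n : ℕ} (x₀ x₁ : ZMod 2) (y : Bits n) :
    twoH (chain (n + 3)) (Fin.cons x₀ (Fin.cons x₁ (Fin.cons 1 y))) =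
      2 + twoH (chain (n + 1)) (Fin.cons 1 y) := by
  refine twoH_of_kerCard (k := 0) (by omega) ?_
  rw [kerCard, sum_bits_succ, sum_bits_succ]
  simp [kerCard, extend_cons, annihilates_one_third, ite_and]

theorem twoH_one_zero {n : ℕ} (x₀ : ZMod 2) (y : Bits n) :
    twoH (chain (n + 3)) (Fin.cons x₀ (Fin.cons 1 (Fin.cons 0 y))) = 2 + twoH (chain n) y := by
  refine twoH_of_kerCard (k := 1) (by omega) ?_
  rw [kerCard, kerCard, Finset.mul_sum, sum_bits_succ, sum_bits_succ, sum_bits_succ]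
  simp [extend_cons, annihilates_one_zero, ite_and]

theorem twoH_zero_zero_zero {n : ℕ} (y : Bits n) :
    twoH (chain (n + 3)) (Fin.cons 0 (Fin.cons 0 (Fin.cons 0 y))) =
      twoH (chain (n + 2)) (Fin.cons 0 (Fin.cons 0 y)) := by
  rw [← zero_add (twoH (chain (n + 2)) _)]
  refine twoH_of_kerCard (k := 1) (by omega) ?_
  rw [kerCard, kerCard, Finset.mul_sum, sum_bits_succ]
  simp [extend_cons, annihilates_zero_zero_zero]

theorem twoH_one_zero_zero_one {n : ℕ} (y : Bits n) :
    twoH (chain (n + 4)) (Fin.cons 1 (Fin.cons 0 (Fin.cons 0 (Fin.cons 1 y)))) =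
      twoH (chain (n + 2)) (Fin.cons 0 (Fin.cons 1 y)) := by
  rw [← zero_add (twoH (chain (n + 2)) _)]
  refine twoH_of_kerCard (k := 2) (by omega) ?_
  rw [kerCard, kerCard, Finset.mul_sum, sum_bits_succ, sum_bits_succ]
  simp [extend_cons, annihilates_one_zero_zero_one]

theorem twoH_one_zero_zero_zero {n : ℕ} (y : Bits n) :
    twoH (chain (n + 4)) (Fin.cons 1 (Fin.cons 0 (Fin.cons 0 (Fin.cons 0 y)))) =
      2 + twoH (chain (n + 1)) (Fin.cons 0 y) := by
  refine twoH_of_kerCard (k := 1) (by omega) ?_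
  rw [kerCard, kerCard, Finset.mul_sum, sum_bits_succ, sum_bits_succ, sum_bits_succ]
  simp [extend_cons, annihilates_one_zero_zero_zero, ite_and]

theorem twoH_one_zero_zero (y : Bits 0) :
    twoH (chain 3) (Fin.cons 1 (Fin.cons 0 (Fin.cons 0 y))) = 2 + twoH (chain 0) y := by
  have hy : extend y = pcons 0 (extend y) := by
    funext n; cases n <;> simp [extend, pcons]
  refine twoH_of_kerCard (k := 1) (by omega) ?_
  rw [kerCard, kerCard, Finset.mul_sum, sum_bits_succ, sum_bits_succ, sum_bits_succ]
  simp only [extend_cons]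
  -- The chain has no fourth bit, so a zero of the padding plays its part in the pattern `1000`.
  rw [hy]
  have h := annihilates_one_zero_zero_zero 0
  simp only [zero_add] at h
  simp only [h, ite_and]
  simp [Annihilates]

theorem twoH_of_le_two {N : ℕ} (hN : N ≤ 2) (x : Bits N) : twoH (chain N) x = 0 := by
  have h : cMatrix (chain N) x + (cMatrix (chain N) x)ᵀ = 0 := by
    ext i j
    rw [cMatrix_add_transpose_apply fun e => card_of_mem_chain]
    refine Finset.sum_eq_zero fun k _ => if_neg ?_
    rw [mem_chain_iff]
    unfold Consecutive
    omega
  rw [twoH, h, Matrix.rank_zero]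

/-! ### Recursions for the partially fixed moments. -/

/-- The summand `2^{(1-α) 2h(x)}` of the moments of the chain. -/
def weight (α : ℝ) {N : ℕ} (x : Bits N) : ℝ := (2 : ℝ) ^ ((1 - α) * (twoH (chain N) x : ℝ))

theorem weight_of_add_two {α : ℝ} {N n : ℕ} {x : Bits N} {y : Bits n}
    (h : twoH (chain N) x = 2 + twoH (chain n) y) : weight α x = β α * weight α y := by
  rw [weight, weight, β, ← Real.rpow_add two_pos, h]
  push_cast
  ring_nf

theorem weight_of_eq {α : ℝ} {N n : ℕ} {x : Bits N} {y : Bits n}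
    (h : twoH (chain N) x = twoH (chain n) y) : weight α x = weight α y := by
  rw [weight, weight, h]

theorem m_nil (α : ℝ) (N : ℕ) : m α N [] = (1 / 2 ^ N) * ∑ x : Bits N, weight α x := by
  simp [m, fixedMoment, weight]

theorem m_singleton (α : ℝ) (n : ℕ) (a : ZMod 2) :
    m α (n + 1) [a] = (1 / 2 ^ n) * ∑ y : Bits n, weight α (Fin.cons a y : Bits (n + 1)) := by
  have hA : (Finset.univ.filter fun i : Fin (n + 1) => (i : ℕ) < 1) = {0} := by
    ext i
    simp only [Finset.mem_filter, Finset.mem_univ, true_and, Finset.mem_singleton]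
    rw [Fin.ext_iff, Fin.val_zero]
    omega
  simp only [m, fixedMoment, List.length_singleton, hA, Finset.card_singleton, Finset.mem_singleton,
    forall_eq, Nat.add_sub_cancel]
  rw [Finset.sum_filter, sum_bits_succ]
  simp [weight]

theorem m_pair (α : ℝ) (n : ℕ) (a b : ZMod 2) :
    m α (n + 2) [a, b] =
      (1 / 2 ^ n) * ∑ y : Bits n, weight α (Fin.cons a (Fin.cons b y) : Bits (n + 2)) := by
  have hA : (Finset.univ.filter fun i : Fin (n + 2) => (i : ℕ) < 2) = {0, 1} := by
    ext i
    simp only [Finset.mem_filter, Finset.mem_univ, true_and, Finset.mem_insert,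
      Finset.mem_singleton]
    rw [Fin.ext_iff, Fin.ext_iff, Fin.val_zero, Fin.val_one]
    omega
  have h1 : ∀ (c d : ZMod 2) (y : Bits n), (Fin.cons c (Fin.cons d y) : Bits (n + 2)) 1 = d :=
    fun _ _ _ => rfl
  simp only [m, fixedMoment, List.length_cons, List.length_nil, Nat.reduceAdd, hA,
    Finset.card_pair (Fin.zero_ne_one (n := n)), Finset.mem_insert, Finset.mem_singleton,
    forall_eq_or_imp, forall_eq, Nat.add_sub_cancel]
  rw [Finset.sum_filter, sum_bits_succ, sum_bits_succ]
  simp [weight, h1, ite_and]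

theorem sum_zmod_two {R : Type*} [AddCommMonoid R] (F : ZMod 2 → R) : ∑ a, F a = F 0 + F 1 :=
  Fin.sum_univ_two F

theorem m_nil_succ (α : ℝ) (n : ℕ) :
    m α (n + 1) [] = (m α (n + 1) [0] + m α (n + 1) [1]) / 2 := by
  simp only [m_nil, m_singleton]
  rw [sum_bits_succ]
  simp only [sum_zmod_two, Finset.sum_add_distrib]
  rw [pow_succ]
  field_simp

theorem m_singleton_succ (α : ℝ) (n : ℕ) (a : ZMod 2) :
    m α (n + 2) [a] = (m α (n + 2) [a, 0] + m α (n + 2) [a, 1]) / 2 := by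
  simp only [m_pair, m_singleton]
  rw [sum_bits_succ]
  simp only [sum_zmod_two, Finset.sum_add_distrib]
  rw [pow_succ]
  field_simp

theorem m_zero_zero (α : ℝ) (n : ℕ) : m α (n + 3) [0, 0] =
    1 / 2 * m α (n + 2) [0, 0] + β α / 2 * m α (n + 1) [1] := by
  rw [m_pair, m_pair, m_singleton, sum_bits_succ]
  simp only [sum_zmod_two, weight_of_eq (twoH_zero_zero_zero _),
    weight_of_add_two (twoH_one_third _ _ _), Finset.sum_add_distrib, ← Finset.mul_sum]
  rw [pow_succ]
  field_simp

theorem m_zero_one (α : ℝ) (n : ℕ) : m α (n + 3) [0, 1] =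
    β α / 2 * m α (n + 1) [1] + β α / 2 * m α n [] := by
  rw [m_pair, m_nil, m_singleton, sum_bits_succ]
  simp only [sum_zmod_two, weight_of_add_two (twoH_one_zero _ _),
    weight_of_add_two (twoH_one_third _ _ _), Finset.sum_add_distrib, ← Finset.mul_sum]
  rw [pow_succ]
  field_simp
  ring

/-- The four terms are the prefixes `1*1`, `1001`, `110` and `1000`, with conditional probabilities
`1/2`, `1/8`, `1/4`, `1/8`; all but `1001` lower the rank by 2. -/
theorem m_one (α : ℝ) (n : ℕ) : m α (n + 4) [1] =
    β α / 2 * m α (n + 2) [1] + 1 / 8 * m α (n + 2) [0, 1]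
      + β α / 4 * m α (n + 1) [] + β α / 8 * m α (n + 1) [0] := by
  rw [m_singleton_succ, m_pair, m_pair, m_pair, m_nil, m_singleton, m_singleton, sum_bits_succ,
    sum_bits_succ (fun y => weight α (Fin.cons 1 (Fin.cons 1 y) : Bits (n + 4)))]
  simp only [sum_zmod_two, weight_of_add_two (twoH_one_zero _ _),
    weight_of_add_two (twoH_one_third _ _ _), Finset.sum_add_distrib, ← Finset.mul_sum]
  rw [sum_bits_succ (fun y => weight α (Fin.cons 1 (Fin.cons 0 (Fin.cons 0 y)) : Bits (n + 4)))]
  simp only [sum_zmod_two, weight_of_eq (twoH_one_zero_zero_one _),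
    weight_of_add_two (twoH_one_zero_zero_zero _), Finset.sum_add_distrib, ← Finset.mul_sum]
  rw [pow_succ, pow_succ]
  field_simp
  ring

theorem weight_of_le_two (α : ℝ) {N : ℕ} (hN : N ≤ 2) (x : Bits N) : weight α x = 1 := by
  simp [weight, twoH_of_le_two hN]

/-! ### Sign sums of quadratic forms over `GF(2)`. -/

/-- The nontrivial character of `GF(2)`. -/
def sgn (a : ZMod 2) : ℝ := if a = 1 then -1 else 1

theorem zmod_two_cases (a : ZMod 2) : a = 0 ∨ a = 1 := by revert a; decide

@[simp] theorem sgn_zero : sgn 0 = 1 := by simp [sgn]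

@[simp] theorem sgn_one : sgn 1 = -1 := by simp [sgn]

theorem sgn_add (a b : ZMod 2) : sgn (a + b) = sgn a * sgn b := by
  rcases zmod_two_cases a with rfl | rfl <;> rcases zmod_two_cases b with rfl | rfl <;>
    simp [CharTwo.add_self_eq_zero]

theorem sgn_mul_self (a : ZMod 2) : sgn a * sgn a = 1 := by
  rw [← sgn_add, CharTwo.add_self_eq_zero, sgn_zero]

theorem sgn_sum {ι : Type*} (s : Finset ι) (f : ι → ZMod 2) :
    sgn (∑ i ∈ s, f i) = ∏ i ∈ s, sgn (f i) := by
  classical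
  induction s using Finset.induction_on with
  | empty => simp
  | insert a s ha ih => rw [Finset.sum_insert ha, Finset.prod_insert ha, sgn_add, ih]

/-- Translation by a basis vector `e_i` with `c i = 1` flips every sign. -/
theorem sum_sgn_dotProduct {N : ℕ} (c : Bits N) :
    ∑ a : Bits N, sgn (a ⬝ᵥ c) = if c = 0 then 2 ^ N else 0 := by
  split_ifs with h
  · simp [h]
  · obtain ⟨i, hi⟩ : ∃ i, c i ≠ 0 := by
      by_contra! h'
      exact h (funext h')
    have hi1 : c i = 1 := (zmod_two_cases _).resolve_left hi
    have := Equiv.sum_comp (Equiv.addRight (Pi.single i 1 : Bits N)) fun a => sgn (a ⬝ᵥ c)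
    simp only [Equiv.coe_addRight, add_dotProduct, single_one_dotProduct, hi1, sgn_add, sgn_one,
      mul_neg, mul_one, Finset.sum_neg_distrib] at this
    linarith

/-- Substituting `a + b` for the second variable cancels `g a`; the sum over `a` is then a character
sum that vanishes unless `M *ᵥ b = 0`. -/
theorem sq_sum_sgn_eq {N : ℕ} (g : Bits N → ZMod 2) (M : Matrix (Fin N) (Fin N) (ZMod 2))
    (hg : ∀ a b, g (a + b) = g a + g b + g 0 + a ⬝ᵥ (M *ᵥ b)) :
    (∑ a, sgn (g a)) ^ 2 = 2 ^ N * ∑ b with M *ᵥ b = 0, sgn (g b + g 0) := by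
  calc (∑ a, sgn (g a)) ^ 2 = ∑ a, ∑ b, sgn (g a) * sgn (g b) := by
        rw [sq, Finset.sum_mul_sum]
    _ = ∑ a, ∑ b, sgn (g a) * sgn (g (a + b)) :=
        Finset.sum_congr rfl fun a _ =>
          (Equiv.sum_comp (Equiv.addLeft a) fun b => sgn (g a) * sgn (g b)).symm
    _ = ∑ a, ∑ b, sgn (g b + g 0) * sgn (a ⬝ᵥ (M *ᵥ b)) := by
        refine Finset.sum_congr rfl fun a _ => Finset.sum_congr rfl fun b _ => ?_
        rw [hg, sgn_add, sgn_add, sgn_add, sgn_add]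
        linear_combination (sgn (g b) * sgn (g 0) * sgn (a ⬝ᵥ (M *ᵥ b))) * sgn_mul_self (g a)
    _ = ∑ b, sgn (g b + g 0) * ∑ a : Bits N, sgn (a ⬝ᵥ (M *ᵥ b)) := by
        rw [Finset.sum_comm]
        simp only [Finset.mul_sum]
    _ = _ := by
        simp only [sum_sgn_dotProduct, mul_ite, mul_zero]
        rw [← Finset.sum_filter, Finset.mul_sum]
        simp only [mul_comm]

/-- The square of the exponential sum of a quadratic form vanishes or is determined by the kernel of
its polarization. -/
theorem sq_sum_sgn_eq_zero_or {N : ℕ} (g : Bits N → ZMod 2) (M : Matrix (Fin N) (Fin N) (ZMod 2))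
    (hg : ∀ a b, g (a + b) = g a + g b + g 0 + a ⬝ᵥ (M *ᵥ b)) :
    (∑ a, sgn (g a)) ^ 2 = 0 ∨ (∑ a, sgn (g a)) ^ 2 =
      2 ^ N * ((Finset.univ.filter fun v : Bits N => M *ᵥ v = 0).card : ℝ) := by
  rw [sq_sum_sgn_eq g M hg]
  -- On the kernel `b ↦ g b + g 0` is additive: either translation by some `c` flips all signs, or
  -- every term is 1.
  by_cases h : ∃ c, M *ᵥ c = 0 ∧ g c + g 0 = 1
  · left
    obtain ⟨c, hc, hgc⟩ := h
    have hs : ∑ b with M *ᵥ b = 0, sgn (g b + g 0) = -∑ b with M *ᵥ b = 0, sgn (g b + g 0) := by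
      rw [← Finset.sum_neg_distrib, Finset.sum_filter, Finset.sum_filter,
        ← Equiv.sum_comp (Equiv.addRight c)]
      refine Finset.sum_congr rfl fun b _ => ?_
      simp only [Equiv.coe_addRight, Matrix.mulVec_add, hc, add_zero]
      refine if_congr Iff.rfl ?_ rfl
      rw [hg, hc, dotProduct_zero, add_zero, add_assoc (g b), hgc,
        show g b + 1 + g 0 = g b + g 0 + 1 by ring, sgn_add _ 1, sgn_one, mul_neg_one]
    rw [show ∑ b with M *ᵥ b = 0, sgn (g b + g 0) = 0 by linarith, mul_zero]
  · right
    push Not at h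
    congr 1
    rw [Finset.cast_card]
    refine Finset.sum_congr rfl fun b hb => ?_
    rw [(zmod_two_cases _).resolve_right (h b (by simpa using hb)), sgn_zero]

/-- Parseval: orthogonality in `z` leaves only the diagonal `a = b`. -/
theorem sum_sq_sum_sgn {N : ℕ} (g : Bits N → ZMod 2) :
    ∑ z : Bits N, (∑ a, sgn (g a + z ⬝ᵥ a)) ^ 2 = 2 ^ N * 2 ^ N := by
  calc ∑ z : Bits N, (∑ a, sgn (g a + z ⬝ᵥ a)) ^ 2
      = ∑ z : Bits N, ∑ a, ∑ b, sgn (g a) * sgn (g b) * sgn (z ⬝ᵥ (a + b)) := by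
        refine Finset.sum_congr rfl fun z _ => ?_
        rw [sq, Finset.sum_mul_sum]
        refine Finset.sum_congr rfl fun a _ => Finset.sum_congr rfl fun b _ => ?_
        rw [dotProduct_add, sgn_add, sgn_add, sgn_add]
        ring
    _ = ∑ a, ∑ b, sgn (g a) * sgn (g b) * ∑ z : Bits N, sgn (z ⬝ᵥ (a + b)) := by
        rw [Finset.sum_comm]
        refine Finset.sum_congr rfl fun a _ => ?_
        rw [Finset.sum_comm]
        simp only [Finset.mul_sum]
    _ = ∑ a, ∑ b, if a = b then 2 ^ N else 0 := by
        refine Finset.sum_congr rfl fun a _ => Finset.sum_congr rfl fun b _ => ?_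
        rw [sum_sgn_dotProduct]
        have hab : a + b = 0 ↔ a = b := by
          simp only [funext_iff, Pi.add_apply, Pi.zero_apply, CharTwo.add_eq_zero]
        simp only [hab]
        split_ifs with h
        · rw [h, sgn_mul_self, one_mul]
        · rw [mul_zero]
    _ = _ := by simp

/-! ### Pauli expectations of hypergraph states. -/

/-- The cubic form `∑_{e ∈ E} ∏_{i ∈ e} a_i`. -/
def edgeForm {N : ℕ} (E : Finset (Finset (Fin N))) (a : Bits N) : ZMod 2 := ∑ e ∈ E, ∏ i ∈ e, a i

/-- The third difference of a monomial `y_p y_q y_r` at 0 is its full polarization, the sum over the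
six orderings of the edge. The matrix product sums the same terms, grouped by edge. -/
theorem edgeForm_polarization {N : ℕ} {E : Finset (Finset (Fin N))} (hE : ∀ e ∈ E, e.card = 3)
    (x a b : Bits N) :
    edgeForm E (a + b) + edgeForm E (a + b + x) =
      (edgeForm E a + edgeForm E (a + x)) + (edgeForm E b + edgeForm E (b + x))
        + (edgeForm E 0 + edgeForm E (0 + x))
        + a ⬝ᵥ ((cMatrix E x + (cMatrix E x)ᵀ) *ᵥ b) := by
  have hB : a ⬝ᵥ ((cMatrix E x + (cMatrix E x)ᵀ) *ᵥ b) = ∑ e ∈ E,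
      ∑ t : Fin N × Fin N × Fin N with ({t.1, t.2.1, t.2.2} : Finset (Fin N)) = e,
        a t.1 * b t.2.1 * x t.2.2 := by
    simp only [dotProduct, Matrix.mulVec, cMatrix_add_transpose_apply hE, Finset.mul_sum,
      Finset.sum_mul]
    rw [Finset.sum_fiberwise_eq_sum_filter, Finset.sum_filter, Fintype.sum_prod_type]
    refine Finset.sum_congr rfl fun i _ => ?_
    rw [Fintype.sum_prod_type]
    refine Finset.sum_congr rfl fun j _ => Finset.sum_congr rfl fun k _ => ?_
    split_ifs
    · ring
    · ring
  rw [hB]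
  simp only [edgeForm, ← Finset.sum_add_distrib]
  refine Finset.sum_congr rfl fun e he => ?_
  obtain ⟨p, q, r, hpq, hpr, hqr, rfl⟩ := Finset.card_eq_three.mp (hE e he)
  have hfib : (Finset.univ.filter fun t : Fin N × Fin N × Fin N =>
      ({t.1, t.2.1, t.2.2} : Finset (Fin N)) = {p, q, r}) =
      {(p, q, r), (p, r, q), (q, p, r), (q, r, p), (r, p, q), (r, q, p)} := by
    ext ⟨i, j, k⟩
    simp only [Finset.mem_filter, Finset.mem_univ, true_and, Finset.mem_insert,
      Finset.mem_singleton, Prod.mk.injEq]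
    constructor
    · intro h
      have h1 : ∀ s, s ∈ ({i, j, k} : Finset (Fin N)) ↔ s ∈ ({p, q, r} : Finset (Fin N)) :=
        fun s => by rw [h]
      simp only [Finset.mem_insert, Finset.mem_singleton] at h1
      have := h1 i; have := h1 j; have := h1 k; have := h1 p; have := h1 q; have := h1 r
      grind
    · rintro (⟨rfl, rfl, rfl⟩ | ⟨rfl, rfl, rfl⟩ | ⟨rfl, rfl, rfl⟩ | ⟨rfl, rfl, rfl⟩ |
        ⟨rfl, rfl, rfl⟩ | ⟨rfl, rfl, rfl⟩) <;> (ext; simp; try tauto)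
  have hprod : ∀ y : Bits N, ∏ i ∈ ({p, q, r} : Finset (Fin N)), y i = y p * y q * y r := by
    intro y
    rw [Finset.prod_insert (by simp [hpq, hpr]), Finset.prod_pair hqr, mul_assoc]
  rw [hfib]
  simp only [hprod, Pi.add_apply, Pi.zero_apply]
  rw [Finset.sum_insert (by grind), Finset.sum_insert (by grind), Finset.sum_insert (by grind),
    Finset.sum_insert (by grind), Finset.sum_insert (by grind), Finset.sum_singleton]
  grind

theorem controlledZ_eq_diagonal {N : ℕ} (e : Finset (Fin N)) :
    controlledZ e = Matrix.diagonal fun a : Bits N => ((sgn (∏ i ∈ e, a i) : ℝ) : ℂ) := by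
  have h : ∀ a : Bits N, (∀ i ∈ e, a i = 1) ↔ ∏ i ∈ e, a i = 1 := by
    intro a
    refine ⟨fun h => Finset.prod_eq_one h, fun h i hi => ?_⟩
    refine (zmod_two_cases _).resolve_left fun h0 => ?_
    rw [Finset.prod_eq_zero hi h0] at h
    exact zero_ne_one h
  rw [controlledZ, ← Matrix.diagonal_one, ← Matrix.diagonal_smul, Matrix.diagonal_sub]
  congr 1
  funext a
  simp only [h, sgn, Pi.smul_apply, smul_eq_mul]
  split_ifs <;> norm_num

theorem hypergraphState_apply {N : ℕ} (E : Finset (Finset (Fin N))) (a : Bits N) :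
    hypergraphState E a = (((1 / Real.sqrt 2) ^ N * sgn (edgeForm E a) : ℝ) : ℂ) := by
  have h : ∀ comm, E.noncommProd controlledZ comm =
      Matrix.diagonal fun a : Bits N => ((sgn (edgeForm E a) : ℝ) : ℂ) := by
    induction E using Finset.induction_on with
    | empty => simp [edgeForm]
    | insert e s he ih =>
      intro comm
      rw [Finset.noncommProd_insert_of_notMem _ _ _ _ he, ih, controlledZ_eq_diagonal,
        Matrix.diagonal_mul_diagonal]
      simp only [edgeForm, Finset.sum_insert he, sgn_add, Complex.ofReal_mul]
  have hψ : hypergraphState E =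
      Matrix.diagonal (fun a : Bits N => ((sgn (edgeForm E a) : ℝ) : ℂ)) *ᵥ plusState N :=
    congrArg (· *ᵥ plusState N) (h _)
  rw [hψ, Matrix.mulVec_diagonal, plusState]
  push_cast
  ring

theorem pauliOne_apply (x z b a : ZMod 2) :
    pauliOne x z b a = Complex.I ^ (x.val * z.val) * if b = a + x then ((sgn (z * a) : ℝ) : ℂ)
      else 0 := by
  rcases zmod_two_cases x with rfl | rfl <;> rcases zmod_two_cases z with rfl | rfl <;>
    rcases zmod_two_cases b with rfl | rfl <;> rcases zmod_two_cases a with rfl | rfl <;>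
    simp [pauliOne, pauliX, pauliZ, ZMod.val_one, CharTwo.add_self_eq_zero]

theorem pauliString_apply {N : ℕ} (x z b a : Bits N) :
    pauliString x z b a = Complex.I ^ (∑ i, (x i).val * (z i).val) *
      if b = a + x then ((sgn (z ⬝ᵥ a) : ℝ) : ℂ) else 0 := by
  simp only [pauliString, Matrix.of_apply, pauliOne_apply, Finset.prod_mul_distrib,
    Finset.prod_pow_eq_pow_sum]
  congr 1
  split_ifs with h
  · rw [dotProduct, sgn_sum, Complex.ofReal_prod]
    refine Finset.prod_congr rfl fun i _ => if_pos ?_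
    rw [h]; rfl
  · obtain ⟨i, hi⟩ : ∃ i, b i ≠ (a + x) i := by
      by_contra! h'
      exact h (funext h')
    exact Finset.prod_eq_zero (Finset.mem_univ i) (if_neg hi)

theorem norm_pauliString_expectation {N : ℕ} (E : Finset (Finset (Fin N))) (x z : Bits N) :
    ‖star (hypergraphState E) ⬝ᵥ (pauliString x z *ᵥ hypergraphState E)‖ =
      (1 / 2 ^ N) * |∑ a, sgn (edgeForm E a + edgeForm E (a + x) + z ⬝ᵥ a)| := by
  have h2 : ((1 / Real.sqrt 2) ^ N * (1 / Real.sqrt 2) ^ N : ℝ) = 1 / 2 ^ N := by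
    rw [← mul_pow, div_mul_div_comm, Real.mul_self_sqrt zero_le_two, one_mul, div_pow, one_pow]
  have key : star (hypergraphState E) ⬝ᵥ (pauliString x z *ᵥ hypergraphState E) =
      Complex.I ^ (∑ i, (x i).val * (z i).val) *
        (((1 / 2 ^ N) * ∑ a, sgn (edgeForm E a + edgeForm E (a + x) + z ⬝ᵥ a) : ℝ) : ℂ) := by
    simp only [dotProduct, Matrix.mulVec, Finset.mul_sum]
    rw [Finset.sum_comm, Complex.ofReal_sum, Finset.mul_sum]
    refine Finset.sum_congr rfl fun a _ => ?_
    rw [Finset.sum_eq_single (a + x)]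
    · rw [pauliString_apply, if_pos rfl, Pi.star_apply, hypergraphState_apply,
        hypergraphState_apply, Complex.star_def, Complex.conj_ofReal, ← h2, sgn_add, sgn_add]
      simp only [dotProduct]
      push_cast
      ring
    · intro b _ hb
      rw [pauliString_apply, if_neg hb]
      ring
    · simp
  rw [key, norm_mul, norm_pow, Complex.norm_I, one_pow, one_mul, Complex.norm_real,
    Real.norm_eq_abs, abs_mul, abs_of_nonneg (by positivity : (0 : ℝ) ≤ 1 / 2 ^ N)]

theorem sum_rpow_norm_expectation {N : ℕ} {α : ℝ} (hα : 0 < α) {E : Finset (Finset (Fin N))}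
    (hE : ∀ e ∈ E, e.card = 3) (x : Bits N) :
    ∑ z, ‖star (hypergraphState E) ⬝ᵥ (pauliString x z *ᵥ hypergraphState E)‖ ^ (2 * α) =
      (2 : ℝ) ^ ((1 - α) * (twoH E x : ℝ)) := by
  set t : Bits N → ℝ := fun z => ∑ a, sgn (edgeForm E a + edgeForm E (a + x) + z ⬝ᵥ a) with ht
  -- A squared expectation `q` is 0 or `2^{-2h}`, so `q^α = 2^{(1-α)2h} q` in both cases; the case 0
  -- needs `α ≠ 0`. This makes the sum over `z` linear in the squares, ready for Parseval.
  have hterm : ∀ z, ‖star (hypergraphState E) ⬝ᵥ (pauliString x z *ᵥ hypergraphState E)‖ ^ (2 * α)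
      = (2 : ℝ) ^ ((1 - α) * (twoH E x : ℝ)) * ((1 / (2 ^ N * 2 ^ N)) * t z ^ 2) := by
    intro z
    have hcases := sq_sum_sgn_eq_zero_or
      (fun a => edgeForm E a + edgeForm E (a + x) + z ⬝ᵥ a) (cMatrix E x + (cMatrix E x)ᵀ) (by
        intro a b
        rw [edgeForm_polarization hE, dotProduct_add, dotProduct_zero]
        ring)
    have hK := two_pow_rank_mul_card_ker (cMatrix E x + (cMatrix E x)ᵀ)
    have hK' : (2 : ℝ) ^ twoH E x * ((Finset.univ.filter fun v : Bits N =>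
        (cMatrix E x + (cMatrix E x)ᵀ) *ᵥ v = 0).card : ℝ) = 2 ^ N := by exact_mod_cast hK
    have hsq : ((1 / 2 ^ N) * |t z|) ^ (2 : ℝ) = (1 / (2 ^ N * 2 ^ N)) * t z ^ 2 := by
      rw [Real.rpow_two, mul_pow, sq_abs, div_pow, one_pow, sq ((2 : ℝ) ^ N)]
    rw [norm_pauliString_expectation, Real.rpow_mul (by positivity), hsq]
    rcases hcases with h | h
    · rw [show t z ^ 2 = 0 from h, mul_zero, Real.zero_rpow hα.ne', mul_zero]
    · have hv : (1 / (2 ^ N * 2 ^ N)) * t z ^ 2 = (2 : ℝ) ^ (-(twoH E x : ℝ)) := by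
        rw [show t z ^ 2 = _ from h, Real.rpow_neg zero_le_two, Real.rpow_natCast]
        field_simp
        rw [mul_comm]
        exact hK'
      rw [hv, ← Real.rpow_mul zero_le_two, ← Real.rpow_add two_pos]
      ring_nf
  rw [Finset.sum_congr rfl fun z _ => hterm z, ← Finset.mul_sum, ← Finset.mul_sum,
    sum_sq_sum_sgn fun a => edgeForm E a + edgeForm E (a + x), one_div,
    inv_mul_cancel₀ (by positivity), mul_one]

theorem chainPL_eq {α : ℝ} (hα : 0 < α) (N : ℕ) : chainPL α N = m α N [] := by
  rw [m_nil, chainPL, plMoment]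
  simp only [sum_rpow_norm_expectation hα fun e => card_of_mem_chain, weight]

/-! ### Matrix form, initial values and assembly. -/

theorem transfer_mulVec (α : ℝ) (u v : Fin 3 → ℝ) (w : Fin 2 → ℝ) :
    (transfer α).mulVec (Sum.elim u (Sum.elim v w)) =
      Sum.elim ((matA α).mulVec v + (matB α).mulVec w) (Sum.elim u (matC.mulVec v)) := by
  rw [transfer, Matrix.fromBlocks_mulVec]
  simp only [Sum.elim_comp_inl, Sum.elim_comp_inr, Matrix.zero_mulVec, zero_add,
    Matrix.fromCols_mulVec_sumElim, Matrix.fromRows_mulVec, Matrix.fromBlocks_mulVec,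
    Matrix.one_mulVec, add_zero]
  congr 1
  funext i
  rcases i with i | i <;> simp

theorem m_eq_one (α : ℝ) : m α 0 [] = 1 ∧ (∀ y₀ : ZMod 2, m α 1 [y₀] = 1) ∧
    (∀ y₀ : ZMod 2, m α 2 [y₀] = 1) ∧ ∀ y₀ y₁ : ZMod 2, m α 2 [y₀, y₁] = 1 := by
  refine ⟨?_, fun y₀ => ?_, fun y₀ => ?_, fun y₀ y₁ => ?_⟩
  · simp [m_nil, weight_of_le_two]
  · simp [m_singleton α 0, weight_of_le_two]
  · simp [m_singleton α 1, weight_of_le_two]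
  · simp [m_pair α 0, weight_of_le_two]

theorem m_recursion (α : ℝ) (n : ℕ) :
    m α (n + 4) [0, 0] = 1 / 4 * m α (n + 2) [0, 0] + β α / 2 * m α (n + 2) [1]
      + β α / 4 * m α (n + 1) [1] ∧
    m α (n + 4) [1] = β α / 2 * m α (n + 2) [1] + 1 / 8 * m α (n + 2) [0, 1]
      + β α / 4 * m α (n + 1) [0] + β α / 8 * m α (n + 1) [1] ∧
    m α (n + 4) [0, 1] = β α / 2 * m α (n + 2) [1] + β α / 2 * m α (n + 1) [] := by
  refine ⟨?_, ?_, m_zero_one α (n + 1)⟩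
  -- Two applications of the one-step relation produce the coefficient `1/4`.
  · rw [m_zero_zero α (n + 1), m_zero_zero α n]; ring
  · rw [m_one, m_nil_succ]; ring

theorem vec3_recursion (α : ℝ) (n : ℕ) : vec3 α (n + 4) =
    (matA α).mulVec (vec3 α (n + 2)) + (matB α).mulVec (vec2 α (n + 1)) := by
  obtain ⟨h1, h2, h3⟩ := m_recursion α n
  rw [m_nil_succ] at h3
  funext i
  fin_cases i <;>
    simp [vec3, vec2, matA, matB, h1, h2, h3] <;> ring

theorem vecM_recursion (α : ℝ) (n : ℕ) :
    vecM α (n + 4) = (transfer α).mulVec (vecM α (n + 3)) := by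
  have hC : vec2 α (n + 2) = matC.mulVec (vec3 α (n + 2)) := by
    funext i
    fin_cases i
    · simp [vec3, vec2, matC, Matrix.mulVec, dotProduct, Fin.sum_univ_succ, m_singleton_succ α n 0]
      ring
    · simp [vec3, vec2, matC, Matrix.mulVec, dotProduct, Fin.sum_univ_succ]
  have h4 : vecM α (n + 4) =
    Sum.elim (vec3 α (n + 4)) (Sum.elim (vec3 α (n + 3)) (vec2 α (n + 2))) := rfl
  have h3 : vecM α (n + 3) =
    Sum.elim (vec3 α (n + 3)) (Sum.elim (vec3 α (n + 2)) (vec2 α (n + 1))) := rfl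
  rw [h4, h3, transfer_mulVec, ← vec3_recursion, hC]

theorem m_three (α : ℝ) :
    m α 3 [0, 0] = (1 + β α) / 2 ∧ m α 3 [0, 1] = β α ∧ m α 3 [1] = β α := by
  obtain ⟨h0, h1, h2, h22⟩ := m_eq_one α
  have h3 : m α 3 [0, 1] = β α := by rw [m_zero_one α 0, h0, h1]; ring
  refine ⟨?_, h3, ?_⟩
  · rw [m_zero_zero α 0, h22, h1]; ring
  -- `m_one` starts at length 4, so the four strings of length 3 starting with 1 are evaluated
  -- directly; each has rank 2.
  · rw [m_singleton_succ α 1, m_pair α 1, m_pair α 1, sum_bits_succ, sum_bits_succ]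
    simp only [sum_zmod_two, weight_of_add_two (twoH_one_zero_zero _),
      weight_of_add_two (twoH_one_zero _ _), weight_of_add_two (twoH_one_third _ _ _)]
    simp [weight_of_le_two]
    ring

theorem vecM_eq (α : ℝ) (n : ℕ) :
    vecM α (n + 3) = (transfer α ^ n).mulVec (initM α) := by
  induction n with
  | zero =>
    obtain ⟨h0, h1, h2, h22⟩ := m_eq_one α
    obtain ⟨a, b, c⟩ := m_three α
    simp [vecM, initM, vec3, vec2, a, b, c, h1, h2, h22]
  | succ n ih =>
    rw [vecM_recursion, ih, Matrix.mulVec_mulVec, pow_succ']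

theorem m_nil_eq (α : ℝ) (n : ℕ) : m α (n + 2) [] =
    (m α (n + 2) [0, 0] + m α (n + 2) [0, 1]) / 4 + m α (n + 2) [1] / 2 := by
  rw [m_nil_succ, m_singleton_succ α n 0]; ring

end Hypergraph

end

theorem mainTheorem3 (α : ℝ) :
    -- the three recursion relations
    (∀ N : ℕ, 4 ≤ N →
      Hypergraph.m α N [0, 0] = 1 / 4 * Hypergraph.m α (N - 2) [0, 0]
        + Hypergraph.β α / 2 * Hypergraph.m α (N - 2) [1]
        + Hypergraph.β α / 4 * Hypergraph.m α (N - 3) [1] ∧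
      Hypergraph.m α N [1] = Hypergraph.β α / 2 * Hypergraph.m α (N - 2) [1]
        + 1 / 8 * Hypergraph.m α (N - 2) [0, 1]
        + Hypergraph.β α / 4 * Hypergraph.m α (N - 3) [0]
        + Hypergraph.β α / 8 * Hypergraph.m α (N - 3) [1] ∧
      Hypergraph.m α N [0, 1] = Hypergraph.β α / 2 * Hypergraph.m α (N - 2) [1]
        + Hypergraph.β α / 2 * Hypergraph.m α (N - 3) []) ∧
    -- their matrix forms
    (∀ N : ℕ, 4 ≤ N →
      Hypergraph.vec3 α N = (Hypergraph.matA α).mulVec (Hypergraph.vec3 α (N - 2))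
        + (Hypergraph.matB α).mulVec (Hypergraph.vec2 α (N - 3)) ∧
      Hypergraph.vecM α N = (Hypergraph.transfer α).mulVec (Hypergraph.vecM α (N - 1))) ∧
    -- the initial values
    (Hypergraph.m α 3 [0, 0] = (1 + Hypergraph.β α) / 2 ∧
      Hypergraph.m α 3 [0, 1] = Hypergraph.β α ∧
      Hypergraph.m α 3 [1] = Hypergraph.β α ∧
      Hypergraph.m α 4 [0, 0] = (1 + 3 * Hypergraph.β α) / 4 ∧
      Hypergraph.m α 4 [0, 1] = Hypergraph.β α ∧
      Hypergraph.m α 4 [1] = (1 + 7 * Hypergraph.β α) / 8 ∧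
      (∀ y₀ y₁ : ZMod 2, Hypergraph.m α 2 [y₀, y₁] = 1) ∧
      (∀ y₀ : ZMod 2, Hypergraph.m α 2 [y₀] = 1) ∧
      (∀ y₀ : ZMod 2, Hypergraph.m α 1 [y₀] = 1)) ∧
    -- the full moment in terms of the partially fixed ones
    (∀ N : ℕ, 2 ≤ N →
      Hypergraph.m α N [] = (Hypergraph.m α N [0, 0] + Hypergraph.m α N [0, 1]) / 4
        + Hypergraph.m α N [1] / 2) ∧
    -- the solution of the recursion
    (∀ N : ℕ, 3 ≤ N →
      Hypergraph.vecM α N = (Hypergraph.transfer α ^ (N - 3)).mulVec (Hypergraph.initM α)) ∧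
    -- the Pauli-Liouville moment of the hypergraph state, exactly, for all `N`
    (0 < α →
      (∀ N : ℕ, Hypergraph.chainPL α N = Hypergraph.m α N []) ∧
      (∀ N : ℕ, N ≤ 2 → Hypergraph.chainPL α N = 1) ∧
      (∀ N : ℕ, 3 ≤ N → Hypergraph.chainPL α N =
        Hypergraph.total ((Hypergraph.transfer α ^ (N - 3)).mulVec (Hypergraph.initM α)))) := by
  open Hypergraph in
  refine ⟨fun N hN => ?_, fun N hN => ?_, ?_, fun N hN => ?_, fun N hN => ?_,
    fun hα => ⟨chainPL_eq hα, fun N hN => ?_, fun N hN => ?_⟩⟩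
  · obtain ⟨n, rfl⟩ := Nat.exists_eq_add_of_le' hN
    exact m_recursion α n
  · obtain ⟨n, rfl⟩ := Nat.exists_eq_add_of_le' hN
    exact ⟨vec3_recursion α n, vecM_recursion α n⟩
  · obtain ⟨h0, h1, h2, h22⟩ := m_eq_one α
    obtain ⟨a, b, c⟩ := m_three α
    obtain ⟨h, h', h''⟩ := m_recursion α 0
    refine ⟨a, b, c, ?_, ?_, ?_, h22, h2, h1⟩
    · rw [h, h22, h2, h1]; ring
    · rw [h'', h2, m_nil_succ, h1, h1]; ring
    · rw [h', h22, h2, h1, h1]; ring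
  · obtain ⟨n, rfl⟩ := Nat.exists_eq_add_of_le' hN
    exact m_nil_eq α n
  · obtain ⟨n, rfl⟩ := Nat.exists_eq_add_of_le' hN
    exact vecM_eq α n
  · rw [chainPL_eq hα, m_nil]
    simp [weight_of_le_two α hN]
  · obtain ⟨n, rfl⟩ := Nat.exists_eq_add_of_le' hN
    rw [chainPL_eq hα, m_nil_eq α (n + 1), Nat.add_sub_cancel, ← vecM_eq]
    rfl
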